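/- **Syntax.** Formulae over propositional variables $p$ are $A ::= p \mid \top \mid \bot \mid \top^* \mid A\land B \mid A\to B \mid A * B \mid A \mathbin{-\!*} B$. The set $\mathcal L$ of labels is enumerated without repetition as $a_0,a_1,a_2,\dots$ with $a_0=\epsilon$ the label constant and all other labels label variables. A relational atom is $x=y$, $x\neq y$ or $(x,y\triangleright z)$ with $x,y,z\in\mathcal L$; a labelled formula is $a:A$; a sequent $\mathcal G;\Gamma\vdash\Delta$ consists of a set $\mathcal G$ of relational atoms and sets $\Gamma,\Delta$ of labelled formulae. $E(\mathcal G)\vdash x=y$ means that $(x,y)$ is in the least equivalence relation on $\mathcal L$ containing all $(u,v)$ with $(u=v)\in\mathcal G$; $x=_{\mathcal G}y$ means $E(\mathcal G_f)\vdash x=y$ for some finite $\mathcal G_f\subseteq\mathcal G$. **Frame axioms.** A frame axiom has the form $$\forall x_1,\dots,x_m.\,(s_1=t_1\,\&\cdots\&\,s_p=t_p\,\&\,S_1\,\&\cdots\&\,S_k\Rightarrow\exists y_1,\dots,y_n.\,(T_1\,\&\cdots\&\,T_l)),$$ where the $s_i,t_i$ are variables $x_u$ or $\epsilon$, the $S_i$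 are inequalities or ternary atoms over the $x$'s and $\epsilon$, and the $T_i$ are relational atoms over the $x$'s, $y$'s and $\epsilon$. Fix a finite family $\mathcal{F}r$ of frame axioms. Let $k_{max}$ and $n_{max}$ be the largest $k$ and $n$ in $\mathcal{F}r$ ($0$ if $\mathcal{F}r$ is empty) and $\alpha=\max(n_{max},2)$. **Calculus.** The corresponding instance of $LS_G$ has the following (cut-free) rules, written premises $\Rightarrow$ conclusion, with semicolons denoting union. $id$: $\mathcal G;\Gamma;w:p\vdash w':p;\Delta$ if $E(\mathcal G)\vdash w=w'$. $\bot L$: $\mathcal G;\Gamma;w:\bot\vdash\Delta$. $\top R$: $\mathcal G;\Gamma\vdash w:\top;\Delta$. $\top^*L$: $\mathcal G;w=\epsilon;\Gamma\vdash\Delta\ \Rightarrow\ \mathcal G;\Gamma;w:\top^*\vdash\Delta$. $\top^*R$: $\mathcal G;\Gamma\vdash w:\top^*;\Delta$ if $E(\mathcal G)\vdash w=\epsilon$. The usual classical rules for $\land$ and $\to$, acting on one label. $*L$: $\mathcal G;(x,y\triangleright z);\Gamma;x:A;y:B\vdash\Delta\ \Rightarrow\ \mathcal G;\Gamma;z:A*B\vdash\Delta$,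 with $x,y$ fresh. $*R$: if $E(\mathcal G)\vdash z=z'$, from $\mathcal G;(x,y\triangleright z');\Gamma\vdash x:A;z:A*B;\Delta$ and $\mathcal G;(x,y\triangleright z');\Gamma\vdash y:B;z:A*B;\Delta$ infer $\mathcal G;(x,y\triangleright z');\Gamma\vdash z:A*B;\Delta$. $-\!*L$: if $E(\mathcal G)\vdash z=z'$, from $\mathcal G;(x,z'\triangleright y);\Gamma;z:A\mathbin{-\!*}B\vdash x:A;\Delta$ and $\mathcal G;(x,z'\triangleright y);\Gamma;z:A\mathbin{-\!*}B;y:B\vdash\Delta$ infer $\mathcal G;(x,z'\triangleright y);\Gamma;z:A\mathbin{-\!*}B\vdash\Delta$. $-\!*R$: $\mathcal G;(x,z\triangleright y);\Gamma;x:A\vdash y:B;\Delta\ \Rightarrow\ \mathcal G;\Gamma\vdash z:A\mathbin{-\!*}B;\Delta$, with $x,y$ fresh. $NEq$: $\mathcal G;w\neq w';\Gamma\vdash\Delta$ if $E(\mathcal G)\vdash w=w'$. $EM$: from $\mathcal G;w=w';\Gamma\vdash\Delta$ and $\mathcal G;w\neq w';\Gamma\vdash\Delta$ infer $\mathcal G;\Gamma\vdash\Delta$.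 For each frame axiom in $\mathcal{F}r$ and all substitutions $\theta$ of labels for $x_1,\dots,x_m$ and $\sigma$ of fresh labels for $y_1,\dots,y_n$: if $E(\mathcal G)\vdash s_i\theta=t_i\theta$ for all $i$, from $\mathcal G;S_1\theta;\dots;S_k\theta;(T_1\theta)\sigma;\dots;(T_l\theta)\sigma;\Gamma\vdash\Delta$ infer $\mathcal G;S_1\theta;\dots;S_k\theta;\Gamma\vdash\Delta$. Fresh labels are pairwise distinct labels other than $\epsilon$ that do not occur in the conclusion (nor, in the last rule, among the $x_i\theta$). $F$ is *unprovable* if $\vdash w:F$ has no derivation for any label $w\neq\epsilon$. **Scheduler.** Extended formulae are the formulae, a constant $\mathbb{EM}$, and a constant $\mathbb{GS}_{j,\theta}$ for each $j$-th frame axiom and each substitution $\theta$ of labels for its variables $x_1,\dots,x_m$. A schedule is $(O,m,\mathcal F,\mathcal R)$ with $O\in\{0,1\}$, $m\in\mathcal L$, $\mathcal F$ an extended formula and $\mathcal R$ a set of at most $\max(1,k_{max})$ relational atoms. A scheduler $\phi$ is a function from $\mathbb N$ to schedules; it is fair if every schedule is $\phi(i)$ for infinitely many $i$. Fix a fair scheduler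 $\phi$. **Construction.** Put $\mathcal G_1=\Gamma_1=\emptyset$, $\Delta_1=\{a_1:F\}$. For $i\ge1$ let $\phi(i)=(O,m,\mathcal F,\mathcal R)$ and obtain the $(i+1)$-st sequent from the $i$-th one as follows. * $O=0$, $\mathcal F=C$ a formula, $m:C\in\Gamma_i$. $C=A\land B$: add $m:A,m:B$ to $\Gamma$. $C=A\to B$: add $m:A$ to $\Delta$ if $\mathcal G_i;\Gamma_i\vdash m:A;\Delta_i$ is not derivable, otherwise $m:B$ to $\Gamma$. $C=\top^*$: add $m=\epsilon$ to $\mathcal G$. $C=A*B$: add $(a_{\alpha i},a_{\alpha i+1}\triangleright m)$ to $\mathcal G$ and $a_{\alpha i}:A$, $a_{\alpha i+1}:B$ to $\Gamma$. $C=A\mathbin{-\!*}B$, $\mathcal R=\{(x,m'\triangleright y)\}\subseteq\mathcal G_i$ and $E(\mathcal G_i)\vdash m'=m$: add $x:A$ to $\Delta$ if $\mathcal G_i;\Gamma_i\vdash x:A;\Delta_i$ is not derivable, otherwise $y:B$ to $\Gamma$. * $O=1$, $\mathcal F=C$ a formula, $m:C\in\Delta_i$. $C=A\land B$: add $m:A$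 to $\Delta$ if $\mathcal G_i;\Gamma_i\vdash m:A;\Delta_i$ is not derivable, otherwise $m:B$ to $\Delta$. $C=A\to B$: add $m:A$ to $\Gamma$, $m:B$ to $\Delta$. $C=A*B$, $\mathcal R=\{(x,y\triangleright m')\}\subseteq\mathcal G_i$ and $E(\mathcal G_i)\vdash m=m'$: add $x:A$ to $\Delta$ if $\mathcal G_i;\Gamma_i\vdash x:A;\Delta_i$ is not derivable, otherwise $y:B$ to $\Delta$. $C=A\mathbin{-\!*}B$: add $(a_{\alpha i},m\triangleright a_{\alpha i+1})$ to $\mathcal G$, $a_{\alpha i}:A$ to $\Gamma$, $a_{\alpha i+1}:B$ to $\Delta$. * $\mathcal F=\mathbb{EM}$, $\mathcal R=\{(w,w'\triangleright w'')\}$ with $w,w'\in\{a_0,\dots,a_{\alpha i+\alpha-1}\}$: add $w=w'$ to $\mathcal G$ if $w=w';\mathcal G_i;\Gamma_i\vdash\Delta_i$ is not derivable, otherwise add $w\neq w'$. * $\mathcal F=\mathbb{GS}_{j,\theta}$, and the $j$-th frame axiom satisfies $\{S_1\theta,\dots,S_k\theta\}=\mathcal R\subseteq\mathcal G_i$, $E(\mathcal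 G_i)\vdash s_u\theta=t_u\theta$ for all $u$, and all $x_u\theta$ are in $\{a_0,\dots,a_{\alpha i-1}\}$: add $(T_1\theta)\sigma,\dots,(T_l\theta)\sigma$ to $\mathcal G$, where $y_v\sigma=a_{\alpha i+v-1}$. * In all other cases nothing changes. The *limit sequent for $F$* is $\mathcal G^\omega;\Gamma^\omega\vdash\Delta^\omega$ with $\mathcal G^\omega=\bigcup_{i\ge1}\mathcal G_i$, $\Gamma^\omega=\bigcup_{i\ge1}\Gamma_i$, $\Delta^\omega=\bigcup_{i\ge1}\Delta_i$. **Hintikka sequents.** $\mathcal G;\Gamma\vdash\Delta$ is an *$\mathcal{F}r$-Hintikka sequent* if for all formulae $A,B$ and labels $a,b,z$: (1) not ($a:A\in\Gamma$, $b:A\in\Delta$ and $a=_{\mathcal G}b$); (2) $a:\bot\notin\Gamma$ and $a:\top\notin\Delta$; (3) $a:\top^*\in\Gamma$ implies $a=_{\mathcal G}\epsilon$; (4) $a:\top^*\in\Delta$ implies $a\neq_{\mathcal G}\epsilon$; (5) $a:A\land B\in\Gamma$ implies $a:A\in\Gamma$ and $a:B\in\Gamma$; (6) $a:A\land B\in\Delta$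 implies $a:A\in\Delta$ or $a:B\in\Delta$; (7) $a:A\to B\in\Gamma$ implies $a:A\in\Delta$ or $a:B\in\Gamma$; (8) $a:A\to B\in\Delta$ implies $a:A\in\Gamma$ and $a:B\in\Delta$; (9) $z:A*B\in\Gamma$ implies that there are $x,y,z'$ with $(x,y\triangleright z')\in\mathcal G$, $z=_{\mathcal G}z'$, $x:A\in\Gamma$, $y:B\in\Gamma$; (10) if $z:A*B\in\Delta$, then for all $x,y,z'$ with $(x,y\triangleright z')\in\mathcal G$ and $z=_{\mathcal G}z'$, $x:A\in\Delta$ or $y:B\in\Delta$; (11) if $z:A\mathbin{-\!*}B\in\Gamma$, then for all $x,y,z'$ with $(x,z'\triangleright y)\in\mathcal G$ and $z=_{\mathcal G}z'$, $x:A\in\Delta$ or $y:B\in\Gamma$; (12) $z:A\mathbin{-\!*}B\in\Delta$ implies that there are $x,y,z'$ with $(x,z'\triangleright y)\in\mathcal G$, $z=_{\mathcal G}z'$, $x:A\in\Gamma$, $y:B\in\Delta$; (13) not ($a\neq b\in\mathcal G$ and $a=_{\mathcal G}b$); (14) $a\neq b\in\mathcal G$ or $a=_{\mathcal G}b$; (15)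 for each frame axiom in $\mathcal{F}r$ and each substitution $\theta$ of labels for $x_1,\dots,x_m$, if $\{S_1\theta,\dots,S_k\theta\}\subseteq\mathcal G$ and $s_i\theta=_{\mathcal G}t_i\theta$ for all $i$, then there is a substitution $\sigma$ of labels for $y_1,\dots,y_n$ with $\{(T_1\theta)\sigma,\dots,(T_l\theta)\sigma\}\subseteq\mathcal G$. **Lemma.** For every finite family $\mathcal{F}r$ of frame axioms and every fair scheduler $\phi$, if $F$ is unprovable in the corresponding instance of $LS_G$, then the limit sequent for $F$ is an $\mathcal{F}r$-Hintikka sequent. -/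

import Mathlib

namespace SepLogic

open scoped Classical

/-- Formulae of propositional abstract separation logic over propositional variables `P`
(negation and disjunction are derived connectives). -/
inductive Formula (P : Type*) : Type _
  | var (p : P)
  | top
  | bot
  | emp
  | and (A B : Formula P)
  | imp (A B : Formula P)
  | star (A B : Formula P)
  | wand (A B : Formula P)

/-- Labels: the set of labels is enumerated without repetition as `a₀, a₁, a₂, …`, where `a₀` is
the label constant `ε` and the others are the label variables. The label `aᵢ` is `i`. -/
abbrev Label : Type := ℕ

/-- The label constant for the unit. -/
def eps : Label := 0

/-- Relational atoms over `X`: `x = y`, `x ≠ y`, and the ternary atoms `(x, y ▷ z)`. -/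
inductive RelAtom (X : Type) : Type
  | eq (x y : X)
  | neq (x y : X)
  | tern (x y z : X)

namespace RelAtom

/-- Apply a map to each argument of a relational atom. -/
def map {X Y : Type} (f : X → Y) : RelAtom X → RelAtom Y
  | eq x y => eq (f x) (f y)
  | neq x y => neq (f x) (f y)
  | tern x y z => tern (f x) (f y) (f z)

/-- The set of arguments occurring in a relational atom. -/
def args {X : Type} : RelAtom X → Set X
  | eq x y => {x, y}
  | neq x y => {x, y}
  | tern x y z => {x, y, z}

/-- The atom is an equality. -/
def IsEq {X : Type} : RelAtom X → Prop
  | eq _ _ => True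
  | neq _ _ => False
  | tern _ _ _ => False

end RelAtom

/-- A labelled formula `a : A`. -/
abbrev LFormula (P : Type*) : Type _ := Label × Formula P

/-- A labelled sequent `G; Γ ⊢ Δ` (the three sets may be infinite). -/
@[ext]
structure Sequent (P : Type*) where
  rel : Set (RelAtom Label)
  left : Set (LFormula P)
  right : Set (LFormula P)

/-- The set of labels occurring in a sequent. -/
def Sequent.labels {P : Type*} (s : Sequent P) : Set Label :=
  {a | (∃ r ∈ s.rel, a ∈ r.args) ∨ (∃ C, (a, C) ∈ s.left) ∨ (∃ C, (a, C) ∈ s.right)}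

/-- The equality judgment `E(G) ⊢ x = y`. -/
inductive EqJudg (G : Set (RelAtom Label)) : Label → Label → Prop
  | hyp {x y : Label} : RelAtom.eq x y ∈ G → EqJudg G x y
  | refl (x : Label) : EqJudg G x x
  | symm {x y : Label} : EqJudg G x y → EqJudg G y x
  | trans {x y z : Label} : EqJudg G x y → EqJudg G y z → EqJudg G x z

/-- The relation `x =_G y` for a possibly infinite `G`: the equality judgment holds for some
finite subset of `G`. -/
def EqMod (G : Set (RelAtom Label)) (x y : Label) : Prop :=
  ∃ G' ⊆ G, G'.Finite ∧ EqJudg G' x y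

/-- Terms of frame axioms: a first-order variable or the constant `ε`. -/
inductive LTerm (V : Type) : Type
  | var (v : V)
  | eps

/-- The label obtained from a term by substituting labels for its variables. -/
def LTerm.inst {V : Type} (f : V → Label) : LTerm V → Label
  | .var v => f v
  | .eps => SepLogic.eps

/-- A frame axiom
`∀ x₁ … xₘ. (s₁ = t₁ & … & sₚ = tₚ & S₁ & … & Sₖ ⇒ ∃ y₁ … yₙ. (T₁ & … & Tₗ))`,
where the `Sᵢ` are inequalities or ternary atoms over the `x`'s and `ε`, and the `Tᵢ` are arbitrary
relational atoms over the `x`'s, the `y`'s and `ε`. -/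
structure FrameAxiom where
  m : ℕ
  n : ℕ
  eqs : List (LTerm (Fin m) × LTerm (Fin m))
  hyps : List (RelAtom (LTerm (Fin m)))
  concls : List (RelAtom (LTerm (Fin m ⊕ Fin n)))
  hyps_not_eq : ∀ S ∈ hyps, ¬ S.IsEq

namespace FrameAxiom

/-- The set `{S₁θ, …, Sₖθ}`. -/
def hypsInst (ax : FrameAxiom) (θ : Fin ax.m → Label) : Set (RelAtom Label) :=
  {r | ∃ S ∈ ax.hyps, r = S.map (LTerm.inst θ)}

/-- The set `{(T₁θ)σ, …, (Tₗθ)σ}`. -/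
def conclsInst (ax : FrameAxiom) (θ : Fin ax.m → Label) (σ : Fin ax.n → Label) :
    Set (RelAtom Label) :=
  {r | ∃ T ∈ ax.concls, r = T.map (LTerm.inst (Sum.elim θ σ))}

/-- `E(G) ⊢ sᵢθ = tᵢθ` for all `i`. -/
def EqsHold (ax : FrameAxiom) (G : Set (RelAtom Label)) (θ : Fin ax.m → Label) : Prop :=
  ∀ e ∈ ax.eqs, EqJudg G (e.1.inst θ) (e.2.inst θ)

end FrameAxiom

/-- Cut-free derivability in the instance of `LS_G` whose structural rules are synthesised from the
frame axioms `Fr`. The labels introduced by `starL`, `wandR` and the structural rules are pairwise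
distinct label variables (so different from `ε`) that do not occur in the conclusion. (The premises
of a rule with a finite conclusion are finite, so a derivation of a finite sequent consists of
finite sequents.) -/
inductive Derivable {P : Type*} {q : ℕ} (Fr : Fin q → FrameAxiom) : Sequent P → Prop
  | id {G Γ Δ} {w w' : Label} {p : P} :
      EqJudg G w w' →
      Derivable Fr ⟨G, insert (w, .var p) Γ, insert (w', .var p) Δ⟩
  | botL {G Γ Δ} {w : Label} :
      Derivable Fr ⟨G, insert (w, .bot) Γ, Δ⟩
  | topR {G Γ Δ} {w : Label} :
      Derivable Fr ⟨G, Γ, insert (w, .top) Δ⟩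
  | empL {G Γ Δ} {w : Label} :
      Derivable Fr ⟨insert (.eq w eps) G, Γ, Δ⟩ →
      Derivable Fr ⟨G, insert (w, .emp) Γ, Δ⟩
  | empR {G Γ Δ} {w : Label} :
      EqJudg G w eps →
      Derivable Fr ⟨G, Γ, insert (w, .emp) Δ⟩
  | andL {G Γ Δ} {w : Label} {A B : Formula P} :
      Derivable Fr ⟨G, insert (w, A) (insert (w, B) Γ), Δ⟩ →
      Derivable Fr ⟨G, insert (w, .and A B) Γ, Δ⟩
  | andR {G Γ Δ} {w : Label} {A B : Formula P} :
      Derivable Fr ⟨G, Γ, insert (w, A) Δ⟩ →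
      Derivable Fr ⟨G, Γ, insert (w, B) Δ⟩ →
      Derivable Fr ⟨G, Γ, insert (w, .and A B) Δ⟩
  | impL {G Γ Δ} {w : Label} {A B : Formula P} :
      Derivable Fr ⟨G, Γ, insert (w, A) Δ⟩ →
      Derivable Fr ⟨G, insert (w, B) Γ, Δ⟩ →
      Derivable Fr ⟨G, insert (w, .imp A B) Γ, Δ⟩
  | impR {G Γ Δ} {w : Label} {A B : Formula P} :
      Derivable Fr ⟨G, insert (w, A) Γ, insert (w, B) Δ⟩ →
      Derivable Fr ⟨G, Γ, insert (w, .imp A B) Δ⟩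
  | starL {G Γ Δ} {x y z : Label} {A B : Formula P} :
      x ≠ y → x ≠ eps → y ≠ eps →
      x ∉ Sequent.labels ⟨G, insert (z, .star A B) Γ, Δ⟩ →
      y ∉ Sequent.labels ⟨G, insert (z, .star A B) Γ, Δ⟩ →
      Derivable Fr ⟨insert (.tern x y z) G, insert (x, A) (insert (y, B) Γ), Δ⟩ →
      Derivable Fr ⟨G, insert (z, .star A B) Γ, Δ⟩
  | starR {G Γ Δ} {x y z z' : Label} {A B : Formula P} :
      EqJudg G z z' →
      Derivable Fr ⟨insert (.tern x y z') G, Γ, insert (x, A) (insert (z, .star A B) Δ)⟩ →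
      Derivable Fr ⟨insert (.tern x y z') G, Γ, insert (y, B) (insert (z, .star A B) Δ)⟩ →
      Derivable Fr ⟨insert (.tern x y z') G, Γ, insert (z, .star A B) Δ⟩
  | wandL {G Γ Δ} {x y z z' : Label} {A B : Formula P} :
      EqJudg G z z' →
      Derivable Fr ⟨insert (.tern x z' y) G, insert (z, .wand A B) Γ, insert (x, A) Δ⟩ →
      Derivable Fr ⟨insert (.tern x z' y) G, insert (y, B) (insert (z, .wand A B) Γ), Δ⟩ →
      Derivable Fr ⟨insert (.tern x z' y) G, insert (z, .wand A B) Γ, Δ⟩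
  | wandR {G Γ Δ} {x y z : Label} {A B : Formula P} :
      x ≠ y → x ≠ eps → y ≠ eps →
      x ∉ Sequent.labels ⟨G, Γ, insert (z, .wand A B) Δ⟩ →
      y ∉ Sequent.labels ⟨G, Γ, insert (z, .wand A B) Δ⟩ →
      Derivable Fr ⟨insert (.tern x z y) G, insert (x, A) Γ, insert (y, B) Δ⟩ →
      Derivable Fr ⟨G, Γ, insert (z, .wand A B) Δ⟩
  | nEq {G Γ Δ} {w w' : Label} :
      EqJudg G w w' →
      Derivable Fr ⟨insert (.neq w w') G, Γ, Δ⟩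
  | em {G Γ Δ} (w w' : Label) :
      Derivable Fr ⟨insert (.eq w w') G, Γ, Δ⟩ →
      Derivable Fr ⟨insert (.neq w w') G, Γ, Δ⟩ →
      Derivable Fr ⟨G, Γ, Δ⟩
  | structural {G Γ Δ} (j : Fin q) (θ : Fin (Fr j).m → Label) (σ : Fin (Fr j).n → Label) :
      (Fr j).EqsHold G θ →
      Function.Injective σ →
      (∀ v, σ v ≠ eps ∧ σ v ∉ Set.range θ ∧
        σ v ∉ Sequent.labels ⟨G ∪ (Fr j).hypsInst θ, Γ, Δ⟩) →
      Derivable Fr ⟨G ∪ (Fr j).hypsInst θ ∪ (Fr j).conclsInst θ σ, Γ, Δ⟩ →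
      Derivable Fr ⟨G ∪ (Fr j).hypsInst θ, Γ, Δ⟩

/-- `F` is unprovable: `⊢ w : F` has no cut-free derivation, for any label `w ≠ ε`. -/
def Unprovable {P : Type*} {q : ℕ} (Fr : Fin q → FrameAxiom) (F : Formula P) : Prop :=
  ∀ w : Label, w ≠ eps → ¬ Derivable Fr ⟨∅, ∅, {(w, F)}⟩

/-- The `Fr`-Hintikka sequents: conditions 1 to 14 of general Hintikka sequents, and condition 15
for each frame axiom in `Fr`. -/
structure IsHintikka {P : Type*} {q : ℕ} (Fr : Fin q → FrameAxiom) (s : Sequent P) : Prop where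
  c1 : ∀ (A : Formula P) (a b : Label),
    ¬ ((a, A) ∈ s.left ∧ (b, A) ∈ s.right ∧ EqMod s.rel a b)
  c2 : ∀ a : Label, (a, Formula.bot) ∉ s.left ∧ (a, Formula.top) ∉ s.right
  c3 : ∀ a : Label, (a, Formula.emp) ∈ s.left → EqMod s.rel a eps
  c4 : ∀ a : Label, (a, Formula.emp) ∈ s.right → ¬ EqMod s.rel a eps
  c5 : ∀ (A B : Formula P) (a : Label),
    (a, A.and B) ∈ s.left → (a, A) ∈ s.left ∧ (a, B) ∈ s.left
  c6 : ∀ (A B : Formula P) (a : Label),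
    (a, A.and B) ∈ s.right → (a, A) ∈ s.right ∨ (a, B) ∈ s.right
  c7 : ∀ (A B : Formula P) (a : Label),
    (a, A.imp B) ∈ s.left → (a, A) ∈ s.right ∨ (a, B) ∈ s.left
  c8 : ∀ (A B : Formula P) (a : Label),
    (a, A.imp B) ∈ s.right → (a, A) ∈ s.left ∧ (a, B) ∈ s.right
  c9 : ∀ (A B : Formula P) (z : Label), (z, A.star B) ∈ s.left →
    ∃ x y z' : Label, RelAtom.tern x y z' ∈ s.rel ∧ EqMod s.rel z z' ∧
      (x, A) ∈ s.left ∧ (y, B) ∈ s.left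
  c10 : ∀ (A B : Formula P) (z : Label), (z, A.star B) ∈ s.right →
    ∀ x y z' : Label, RelAtom.tern x y z' ∈ s.rel → EqMod s.rel z z' →
      (x, A) ∈ s.right ∨ (y, B) ∈ s.right
  c11 : ∀ (A B : Formula P) (z : Label), (z, A.wand B) ∈ s.left →
    ∀ x y z' : Label, RelAtom.tern x z' y ∈ s.rel → EqMod s.rel z z' →
      (x, A) ∈ s.right ∨ (y, B) ∈ s.left
  c12 : ∀ (A B : Formula P) (z : Label), (z, A.wand B) ∈ s.right →
    ∃ x y z' : Label, RelAtom.tern x z' y ∈ s.rel ∧ EqMod s.rel z z' ∧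
      (x, A) ∈ s.left ∧ (y, B) ∈ s.right
  c13 : ∀ a b : Label, ¬ (RelAtom.neq a b ∈ s.rel ∧ EqMod s.rel a b)
  c14 : ∀ a b : Label, RelAtom.neq a b ∈ s.rel ∨ EqMod s.rel a b
  c15 : ∀ (j : Fin q) (θ : Fin (Fr j).m → Label),
    (Fr j).hypsInst θ ⊆ s.rel →
    (∀ e ∈ (Fr j).eqs, EqMod s.rel (e.1.inst θ) (e.2.inst θ)) →
    ∃ σ : Fin (Fr j).n → Label, (Fr j).conclsInst θ σ ⊆ s.rel

/-- The largest number of atoms `Sᵢ` in a frame axiom of `Fr` (`0` if `Fr` is empty). -/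
def kMax {q : ℕ} (Fr : Fin q → FrameAxiom) : ℕ :=
  Finset.univ.sup fun j => (Fr j).hyps.length

/-- The largest number of existential variables in a frame axiom of `Fr` (`0` if `Fr` is empty). -/
def nMax {q : ℕ} (Fr : Fin q → FrameAxiom) : ℕ :=
  Finset.univ.sup fun j => (Fr j).n

/-- The number `α = max(n_max, 2)` of labels reserved for each stage. -/
def alpha {q : ℕ} (Fr : Fin q → FrameAxiom) : ℕ := max (nMax Fr) 2

/-- Extended formulae: formulae, and dummy principal formulae for the rule `EM` and for the
instances (given by a substitution `θ` for the universal variables) of the structural rules. -/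
inductive ExFormula (P : Type*) {q : ℕ} (Fr : Fin q → FrameAxiom) : Type _
  | fml (A : Formula P)
  | em
  | gs (j : Fin q) (θ : Fin (Fr j).m → Label)

/-- The side of the turnstile (`0` for left and `1` for right). -/
inductive Side : Type
  | left
  | right

/-- A schedule `(O, m, F, R)`; the set `R` of relational atoms has at most `max(1, k_max)`
elements. -/
structure Schedule (P : Type*) {q : ℕ} (Fr : Fin q → FrameAxiom) where
  side : Side
  label : Label
  exf : ExFormula P Fr
  atoms : Finset (RelAtom Label)
  card_le : atoms.card ≤ max 1 (kMax Fr)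

/-- A scheduler is fair if every schedule occurs infinitely often. -/
def Fair {P : Type*} {q : ℕ} {Fr : Fin q → FrameAxiom} (φ : ℕ → Schedule P Fr) : Prop :=
  ∀ S : Schedule P Fr, {i | φ i = S}.Infinite

/-- The arguments of the ternary atom in a set that consists of exactly one ternary atom. -/
noncomputable def theTern (R : Finset (RelAtom Label)) : Option (Label × Label × Label) :=
  if h : ∃ t : Label × Label × Label, R = {RelAtom.tern t.1 t.2.1 t.2.2} then some h.choose
  else none

theorem theTern_eq_some (R : Finset (RelAtom Label)) (x y z : Label) :
    theTern R = some (x, y, z) ↔ R = {RelAtom.tern x y z} := by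
  unfold theTern
  split_ifs with h
  · have hs := h.choose_spec
    rw [Option.some_inj]
    constructor
    · intro e
      rw [e] at hs
      exact hs
    · intro e
      have hs' := Finset.singleton_inj.mp (e.symm.trans hs)
      injection hs' with h1 h2 h3
      exact Prod.ext h1.symm (Prod.ext h2.symm h3.symm)
  · simp only [false_iff]
    intro e
    exact h ⟨(x, y, z), e⟩

/-- Stage `i` of the construction for a labelled formula `m : C` on the left. -/
noncomputable def stepLeft {P : Type*} {q : ℕ} (Fr : Fin q → FrameAxiom) (i : ℕ) (m : Label)
    (C : Formula P) (R : Finset (RelAtom Label)) (s : Sequent P) : Sequent P :=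
  match C with
  | .and A B => ⟨s.rel, s.left ∪ {(m, A), (m, B)}, s.right⟩
  | .imp A B =>
      if ¬ Derivable Fr ⟨s.rel, s.left, insert (m, A) s.right⟩ then
        ⟨s.rel, s.left, s.right ∪ {(m, A)}⟩
      else ⟨s.rel, s.left ∪ {(m, B)}, s.right⟩
  | .emp => ⟨s.rel ∪ {.eq m eps}, s.left, s.right⟩
  | .star A B =>
      ⟨s.rel ∪ {.tern (alpha Fr * i) (alpha Fr * i + 1) m},
        s.left ∪ {(alpha Fr * i, A), (alpha Fr * i + 1, B)}, s.right⟩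
  | .wand A B =>
      match theTern R with
      | some (x, m', y) =>
          if RelAtom.tern x m' y ∈ s.rel ∧ EqJudg s.rel m' m then
            if ¬ Derivable Fr ⟨s.rel, s.left, insert (x, A) s.right⟩ then
              ⟨s.rel, s.left, s.right ∪ {(x, A)}⟩
            else ⟨s.rel, s.left ∪ {(y, B)}, s.right⟩
          else s
      | none => s
  | _ => s

/-- Stage `i` of the construction for a labelled formula `m : C` on the right. -/
noncomputable def stepRight {P : Type*} {q : ℕ} (Fr : Fin q → FrameAxiom) (i : ℕ) (m : Label)
    (C : Formula P) (R : Finset (RelAtom Label)) (s : Sequent P) : Sequent P :=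
  match C with
  | .and A B =>
      if ¬ Derivable Fr ⟨s.rel, s.left, insert (m, A) s.right⟩ then
        ⟨s.rel, s.left, s.right ∪ {(m, A)}⟩
      else ⟨s.rel, s.left, s.right ∪ {(m, B)}⟩
  | .imp A B => ⟨s.rel, s.left ∪ {(m, A)}, s.right ∪ {(m, B)}⟩
  | .star A B =>
      match theTern R with
      | some (x, y, m') =>
          if RelAtom.tern x y m' ∈ s.rel ∧ EqJudg s.rel m m' then
            if ¬ Derivable Fr ⟨s.rel, s.left, insert (x, A) s.right⟩ then
              ⟨s.rel, s.left, s.right ∪ {(x, A)}⟩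
            else ⟨s.rel, s.left, s.right ∪ {(y, B)}⟩
          else s
      | none => s
  | .wand A B =>
      ⟨s.rel ∪ {.tern (alpha Fr * i) m (alpha Fr * i + 1)},
        s.left ∪ {(alpha Fr * i, A)}, s.right ∪ {(alpha Fr * i + 1, B)}⟩
  | _ => s

/-- The sequent obtained from the `i`-th sequent `s` by the schedule `S`. -/
noncomputable def step {P : Type*} {q : ℕ} {Fr : Fin q → FrameAxiom} (i : ℕ)
    (S : Schedule P Fr) (s : Sequent P) : Sequent P :=
  match S.exf with
  | .fml C =>
      match S.side with
      | .left => if (S.label, C) ∈ s.left then stepLeft Fr i S.label C S.atoms s else s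
      | .right => if (S.label, C) ∈ s.right then stepRight Fr i S.label C S.atoms s else s
  | .em =>
      match theTern S.atoms with
      | some (w, w', _) =>
          if w < alpha Fr * i + alpha Fr ∧ w' < alpha Fr * i + alpha Fr then
            if ¬ Derivable Fr ⟨insert (.eq w w') s.rel, s.left, s.right⟩ then
              ⟨s.rel ∪ {.eq w w'}, s.left, s.right⟩
            else ⟨s.rel ∪ {.neq w w'}, s.left, s.right⟩
          else s
      | none => s
  | .gs j θ =>
      if (Fr j).hypsInst θ = ↑S.atoms ∧ (Fr j).hypsInst θ ⊆ s.rel ∧ (Fr j).EqsHold s.rel θ ∧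
          ∀ u, θ u < alpha Fr * i then
        ⟨s.rel ∪ (Fr j).conclsInst θ (fun v => alpha Fr * i + v), s.left, s.right⟩
      else s

/-- The series of sequents constructed from `F`, which starts with index `1`:
`stage φ F n` is the sequent with index `n + 1`. -/
noncomputable def stage {P : Type*} {q : ℕ} {Fr : Fin q → FrameAxiom} (φ : ℕ → Schedule P Fr)
    (F : Formula P) : ℕ → Sequent P
  | 0 => ⟨∅, ∅, {(1, F)}⟩
  | n + 1 => step (n + 1) (φ (n + 1)) (stage φ F n)

/-- The limit sequent for `F`: the componentwise union of the series of sequents. -/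
noncomputable def limitSequent {P : Type*} {q : ℕ} {Fr : Fin q → FrameAxiom}
    (φ : ℕ → Schedule P Fr) (F : Formula P) : Sequent P :=
  ⟨⋃ n, (stage φ F n).rel, ⋃ n, (stage φ F n).left, ⋃ n, (stage φ F n).right⟩

end SepLogic

/-!
Each rule has a cumulative form, in which the principal formula is kept in the premises. Read from
conclusion to premises, these forms are exactly the steps of the construction, so a step never
turns an underivable sequent into a derivable one: where a rule branches, the construction moves to
a premise that is not derivable. The labels below `α * i` are the only ones used before the `i`-th
step, which provides the fresh labels. Hence every sequent of the series is underivable, and an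
axiom of the calculus (or the identity for arbitrary formulae) applying to the limit would already
apply to one of them. The saturation conditions hold because a fair scheduler returns to a schedule
after the finitely many formulae and atoms that enable it have appeared.
-/

namespace SepLogic

section EqJudg

variable {G H : Set (RelAtom Label)} {x y : Label}

theorem EqJudg.mono (h : G ⊆ H) (e : EqJudg G x y) : EqJudg H x y := by
  induction e with
  | hyp hr => exact .hyp (h hr)
  | refl x => exact .refl x
  | symm _ ih => exact ih.symm
  | trans _ _ ih₁ ih₂ => exact ih₁.trans ih₂

theorem EqJudg.eqMod (e : EqJudg G x y) : EqMod G x y := by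
  induction e with
  | @hyp x y hr => exact ⟨{.eq x y}, by simpa using hr, Set.finite_singleton _, .hyp rfl⟩
  | refl x => exact ⟨∅, Set.empty_subset _, Set.finite_empty, .refl x⟩
  | symm _ ih =>
    obtain ⟨H, hH, hfin, e⟩ := ih
    exact ⟨H, hH, hfin, e.symm⟩
  | trans _ _ ih₁ ih₂ =>
    obtain ⟨H₁, hH₁, hfin₁, e₁⟩ := ih₁
    obtain ⟨H₂, hH₂, hfin₂, e₂⟩ := ih₂
    exact ⟨H₁ ∪ H₂, Set.union_subset hH₁ hH₂, hfin₁.union hfin₂,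
      (e₁.mono Set.subset_union_left).trans (e₂.mono Set.subset_union_right)⟩

end EqJudg

section FrameAxiom

theorem RelAtom.args_eq_subset_iff {X : Type} {x y : X} {T : Set X} :
    (eq x y).args ⊆ T ↔ x ∈ T ∧ y ∈ T :=
  Set.pair_subset_iff

theorem RelAtom.args_neq_subset_iff {X : Type} {x y : X} {T : Set X} :
    (neq x y).args ⊆ T ↔ x ∈ T ∧ y ∈ T :=
  Set.pair_subset_iff

theorem RelAtom.args_tern_subset_iff {X : Type} {x y z : X} {T : Set X} :
    (tern x y z).args ⊆ T ↔ x ∈ T ∧ y ∈ T ∧ z ∈ T := by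
  rw [RelAtom.args, Set.insert_subset_iff, Set.pair_subset_iff]

theorem RelAtom.args_map {X Y : Type} (f : X → Y) (r : RelAtom X) :
    (r.map f).args = f '' r.args := by
  cases r <;> simp only [RelAtom.map, RelAtom.args, Set.image_insert_eq, Set.image_singleton]

theorem LTerm.inst_mem_insert_range {V : Type} (f : V → Label) (t : LTerm V) :
    t.inst f ∈ insert SepLogic.eps (Set.range f) := by
  cases t with
  | var v => exact .inr ⟨v, rfl⟩
  | eps => exact .inl rfl

theorem FrameAxiom.args_subset_of_mem_conclsInst {ax : FrameAxiom} {θ : Fin ax.m → Label}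
    {σ : Fin ax.n → Label} {r : RelAtom Label} (hr : r ∈ ax.conclsInst θ σ) :
    r.args ⊆ insert eps (Set.range θ ∪ Set.range σ) := by
  obtain ⟨T, -, rfl⟩ := hr
  rw [RelAtom.args_map, ← Set.Sum.elim_range]
  rintro _ ⟨t, -, rfl⟩
  exact t.inst_mem_insert_range _

theorem FrameAxiom.exists_finset_coe_eq_hypsInst (ax : FrameAxiom) (θ : Fin ax.m → Label) :
    ∃ R : Finset (RelAtom Label), ↑R = ax.hypsInst θ ∧ R.card ≤ ax.hyps.length := by
  classical
  refine ⟨(ax.hyps.map (RelAtom.map (LTerm.inst θ))).toFinset, ?_, ?_⟩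
  · ext r
    simp [FrameAxiom.hypsInst, eq_comm]
  · exact (List.toFinset_card_le _).trans (List.length_map _).le

variable {q : ℕ} (Fr : Fin q → FrameAxiom)

theorem hyps_length_le_kMax (j : Fin q) : (Fr j).hyps.length ≤ kMax Fr :=
  Finset.le_sup (f := fun j => (Fr j).hyps.length) (Finset.mem_univ j)

theorem n_le_alpha (j : Fin q) : (Fr j).n ≤ alpha Fr :=
  (Finset.le_sup (f := fun j => (Fr j).n) (Finset.mem_univ j)).trans (le_max_left _ _)

theorem two_le_alpha : 2 ≤ alpha Fr :=
  le_max_right _ _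

theorem lt_alpha_mul_succ (n : ℕ) : n < alpha Fr * (n + 1) :=
  Nat.le_mul_of_pos_left _ (two_pos.trans_le (two_le_alpha Fr))

end FrameAxiom

namespace Sequent

variable {P : Type*} {s : Sequent P} {G H : Set (RelAtom Label)} {Γ Δ : Set (LFormula P)}

/-- Sequents are ordered by componentwise inclusion. -/
instance : Preorder (Sequent P) where
  le s t := s.rel ⊆ t.rel ∧ s.left ⊆ t.left ∧ s.right ⊆ t.right
  le_refl _ := ⟨subset_rfl, subset_rfl, subset_rfl⟩
  le_trans _ _ _ h h' := ⟨h.1.trans h'.1, h.2.1.trans h'.2.1, h.2.2.trans h'.2.2⟩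

theorem le_def {s t : Sequent P} :
    s ≤ t ↔ s.rel ⊆ t.rel ∧ s.left ⊆ t.left ∧ s.right ⊆ t.right :=
  Iff.rfl

theorem labels_subset_iff {T : Set Label} : s.labels ⊆ T ↔
    (∀ r ∈ s.rel, r.args ⊆ T) ∧ (∀ c ∈ s.left, c.1 ∈ T) ∧ ∀ c ∈ s.right, c.1 ∈ T := by
  simp only [labels, Set.subset_def, Set.mem_ofPred_eq, Prod.forall]
  grind

theorem labels_union_rel :
    labels ⟨G ∪ H, Γ, Δ⟩ = labels ⟨G, Γ, Δ⟩ ∪ ⋃ r ∈ H, r.args := by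
  ext a
  simp only [labels, Set.mem_union, Set.mem_ofPred_eq, Set.mem_iUnion, exists_prop]
  grind

theorem labels_union_rel_subset {T : Set Label} :
    labels ⟨G ∪ H, Γ, Δ⟩ ⊆ T ↔ labels ⟨G, Γ, Δ⟩ ⊆ T ∧ ∀ r ∈ H, r.args ⊆ T := by
  rw [labels_union_rel, Set.union_subset_iff, Set.iUnion₂_subset_iff]

theorem labels_insert_rel (r : RelAtom Label) :
    labels ⟨insert r G, Γ, Δ⟩ = r.args ∪ labels ⟨G, Γ, Δ⟩ := by
  rw [← Set.union_singleton, labels_union_rel, Set.biUnion_singleton, Set.union_comm]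

theorem labels_insert_left (c : LFormula P) :
    labels ⟨G, insert c Γ, Δ⟩ = insert c.1 (labels ⟨G, Γ, Δ⟩) := by
  ext a
  simp only [labels, Set.mem_insert_iff, Set.mem_ofPred_eq, Prod.ext_iff]
  grind

theorem labels_insert_right (c : LFormula P) :
    labels ⟨G, Γ, insert c Δ⟩ = insert c.1 (labels ⟨G, Γ, Δ⟩) := by
  ext a
  simp only [labels, Set.mem_insert_iff, Set.mem_ofPred_eq, Prod.ext_iff]
  grind

/-- The label `x` is fresh for `s`: a label variable that does not occur in `s`. -/
def Fresh (s : Sequent P) (x : Label) : Prop :=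
  x ≠ eps ∧ x ∉ s.labels

theorem exists_fresh_pair (hs : s.labels.Finite) : ∃ x y, x ≠ y ∧ s.Fresh x ∧ s.Fresh y := by
  obtain ⟨x, hx, y, hy, hxy⟩ := (hs.insert eps).infinite_compl.nontrivial
  exact ⟨x, y, hxy, not_or.1 hx, not_or.1 hy⟩

theorem fresh_of_labels_subset_Iio {N a : ℕ} (hs : s.labels ⊆ Set.Iio N) (hN : 0 < N)
    (ha : N ≤ a) : s.Fresh a :=
  ⟨(hN.trans_le ha).ne', fun h => (hs h).not_ge ha⟩

end Sequent

namespace Derivable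

variable {P : Type*} {q : ℕ} {Fr : Fin q → FrameAxiom} {G : Set (RelAtom Label)}
  {Γ Δ : Set (LFormula P)} {w w' x y z z' : Label} {A B : Formula P}

theorem id_of_mem {p : P} (hl : (w, .var p) ∈ Γ) (hr : (w', .var p) ∈ Δ) (e : EqJudg G w w') :
    Derivable Fr ⟨G, Γ, Δ⟩ := by
  rw [← Set.insert_eq_of_mem hl, ← Set.insert_eq_of_mem hr]
  exact .id e

theorem botL_of_mem (h : (w, .bot) ∈ Γ) : Derivable Fr ⟨G, Γ, Δ⟩ := by
  rw [← Set.insert_eq_of_mem h]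
  exact .botL

theorem topR_of_mem (h : (w, .top) ∈ Δ) : Derivable Fr ⟨G, Γ, Δ⟩ := by
  rw [← Set.insert_eq_of_mem h]
  exact .topR

theorem empL_of_mem (h : (w, .emp) ∈ Γ) (d : Derivable Fr ⟨insert (.eq w eps) G, Γ, Δ⟩) :
    Derivable Fr ⟨G, Γ, Δ⟩ := by
  rw [← Set.insert_eq_of_mem h]
  exact .empL d

theorem empR_of_mem (h : (w, .emp) ∈ Δ) (e : EqJudg G w eps) : Derivable Fr ⟨G, Γ, Δ⟩ := by
  rw [← Set.insert_eq_of_mem h]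
  exact .empR e

theorem andL_of_mem (h : (w, A.and B) ∈ Γ)
    (d : Derivable Fr ⟨G, insert (w, A) (insert (w, B) Γ), Δ⟩) : Derivable Fr ⟨G, Γ, Δ⟩ := by
  rw [← Set.insert_eq_of_mem h]
  exact .andL d

theorem andR_of_mem (h : (w, A.and B) ∈ Δ) (d₁ : Derivable Fr ⟨G, Γ, insert (w, A) Δ⟩)
    (d₂ : Derivable Fr ⟨G, Γ, insert (w, B) Δ⟩) : Derivable Fr ⟨G, Γ, Δ⟩ := by
  rw [← Set.insert_eq_of_mem h]
  exact .andR d₁ d₂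

theorem impL_of_mem (h : (w, A.imp B) ∈ Γ) (d₁ : Derivable Fr ⟨G, Γ, insert (w, A) Δ⟩)
    (d₂ : Derivable Fr ⟨G, insert (w, B) Γ, Δ⟩) : Derivable Fr ⟨G, Γ, Δ⟩ := by
  rw [← Set.insert_eq_of_mem h]
  exact .impL d₁ d₂

theorem impR_of_mem (h : (w, A.imp B) ∈ Δ)
    (d : Derivable Fr ⟨G, insert (w, A) Γ, insert (w, B) Δ⟩) : Derivable Fr ⟨G, Γ, Δ⟩ := by
  rw [← Set.insert_eq_of_mem h]
  exact .impR d

theorem starL_of_mem (h : (z, A.star B) ∈ Γ) (hxy : x ≠ y) (hx : Sequent.Fresh ⟨G, Γ, Δ⟩ x)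
    (hy : Sequent.Fresh ⟨G, Γ, Δ⟩ y)
    (d : Derivable Fr ⟨insert (.tern x y z) G, insert (x, A) (insert (y, B) Γ), Δ⟩) :
    Derivable Fr ⟨G, Γ, Δ⟩ := by
  rw [← Set.insert_eq_of_mem h] at hx hy ⊢
  exact .starL hxy hx.1 hy.1 hx.2 hy.2 d

theorem starR_of_mem (ht : .tern x y z' ∈ G) (h : (z, A.star B) ∈ Δ) (e : EqJudg G z z')
    (d₁ : Derivable Fr ⟨G, Γ, insert (x, A) Δ⟩) (d₂ : Derivable Fr ⟨G, Γ, insert (y, B) Δ⟩) :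
    Derivable Fr ⟨G, Γ, Δ⟩ := by
  rw [← Set.insert_eq_of_mem ht, ← Set.insert_eq_of_mem h] at d₁ d₂ ⊢
  exact .starR e d₁ d₂

theorem wandL_of_mem (ht : .tern x z' y ∈ G) (h : (z, A.wand B) ∈ Γ) (e : EqJudg G z z')
    (d₁ : Derivable Fr ⟨G, Γ, insert (x, A) Δ⟩) (d₂ : Derivable Fr ⟨G, insert (y, B) Γ, Δ⟩) :
    Derivable Fr ⟨G, Γ, Δ⟩ := by
  rw [← Set.insert_eq_of_mem ht, ← Set.insert_eq_of_mem h] at d₁ d₂ ⊢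
  exact .wandL e d₁ d₂

theorem wandR_of_mem (h : (z, A.wand B) ∈ Δ) (hxy : x ≠ y) (hx : Sequent.Fresh ⟨G, Γ, Δ⟩ x)
    (hy : Sequent.Fresh ⟨G, Γ, Δ⟩ y)
    (d : Derivable Fr ⟨insert (.tern x z y) G, insert (x, A) Γ, insert (y, B) Δ⟩) :
    Derivable Fr ⟨G, Γ, Δ⟩ := by
  rw [← Set.insert_eq_of_mem h] at hx hy ⊢
  exact .wandR hxy hx.1 hy.1 hx.2 hy.2 d

theorem nEq_of_mem (h : .neq w w' ∈ G) (e : EqJudg G w w') : Derivable Fr ⟨G, Γ, Δ⟩ := by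
  rw [← Set.insert_eq_of_mem h]
  exact .nEq e

theorem structural_of_subset {j : Fin q} {θ : Fin (Fr j).m → Label} {σ : Fin (Fr j).n → Label}
    (h : (Fr j).hypsInst θ ⊆ G) (e : (Fr j).EqsHold G θ) (hσ : Function.Injective σ)
    (hθ : ∀ v, σ v ∉ Set.range θ) (hfresh : ∀ v, Sequent.Fresh ⟨G, Γ, Δ⟩ (σ v))
    (d : Derivable Fr ⟨G ∪ (Fr j).conclsInst θ σ, Γ, Δ⟩) : Derivable Fr ⟨G, Γ, Δ⟩ := by
  rw [← Set.union_eq_left.2 h] at hfresh d ⊢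
  exact .structural j θ σ e hσ (fun v => ⟨(hfresh v).1, hθ v, (hfresh v).2⟩) d

theorem identity (hfin : (Sequent.labels ⟨G, Γ, Δ⟩).Finite) (hl : (w, A) ∈ Γ)
    (hr : (w', A) ∈ Δ) (e : EqJudg G w w') : Derivable Fr ⟨G, Γ, Δ⟩ := by
  induction A generalizing G Γ Δ w w' with
  | var p => exact .id_of_mem hl hr e
  | top => exact .topR_of_mem hr
  | bot => exact .botL_of_mem hl
  | emp =>
    refine .empL_of_mem hl (.empR_of_mem hr ?_)
    exact (e.symm.mono (Set.subset_insert _ _)).trans (.hyp (Set.mem_insert _ _))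
  | and A B ihA ihB =>
    refine .andL_of_mem hl (.andR_of_mem hr (ihA ?_ (by simp) (by simp) e)
      (ihB ?_ (by simp) (by simp) e))
    all_goals simpa only [Sequent.labels_insert_left, Sequent.labels_insert_right,
      Set.finite_insert] using hfin
  | imp A B ihA ihB =>
    refine .impR_of_mem hr (.impL_of_mem (.inr hl) (ihA ?_ (by simp) (by simp) e.symm)
      (ihB ?_ (by simp) (by simp) e))
    all_goals simpa only [Sequent.labels_insert_left, Sequent.labels_insert_right,
      Set.finite_insert] using hfin
  | star A B ihA ihB =>
    obtain ⟨x, y, hxy, hx, hy⟩ := Sequent.exists_fresh_pair hfin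
    refine .starL_of_mem hl hxy hx hy (.starR_of_mem (Set.mem_insert _ _) hr
      (e.symm.mono (Set.subset_insert _ _)) (ihA ?_ (by simp) (by simp) (.refl x))
      (ihB ?_ (by simp) (by simp) (.refl y)))
    all_goals simpa [Sequent.labels_insert_rel, Sequent.labels_insert_left,
      Sequent.labels_insert_right, RelAtom.args] using hfin
  | wand A B ihA ihB =>
    obtain ⟨x, y, hxy, hx, hy⟩ := Sequent.exists_fresh_pair hfin
    refine .wandR_of_mem hr hxy hx hy (.wandL_of_mem (Set.mem_insert _ _) (.inr hl)
      (e.mono (Set.subset_insert _ _)) (ihA ?_ (by simp) (by simp) (.refl x))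
      (ihB ?_ (by simp) (by simp) (.refl y)))
    all_goals simpa [Sequent.labels_insert_rel, Sequent.labels_insert_left,
      Sequent.labels_insert_right, RelAtom.args] using hfin

end Derivable

section Step

variable {P : Type*} {q : ℕ} {Fr : Fin q → FrameAxiom} {i : ℕ} {m : Label} {C : Formula P}
  {R : Finset (RelAtom Label)} {S : Schedule P Fr} {s : Sequent P}

theorem le_stepLeft : s ≤ stepLeft Fr i m C R s := by
  unfold stepLeft
  repeat' split
  all_goals
    first
    | exact le_rfl
    | refine Sequent.le_def.2 ⟨?_, ?_, ?_⟩ <;>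
        first | exact subset_rfl | exact Set.subset_union_left

theorem le_stepRight : s ≤ stepRight Fr i m C R s := by
  unfold stepRight
  repeat' split
  all_goals
    first
    | exact le_rfl
    | refine Sequent.le_def.2 ⟨?_, ?_, ?_⟩ <;>
        first | exact subset_rfl | exact Set.subset_union_left

theorem le_step : s ≤ step i S s := by
  unfold step
  repeat' split
  all_goals
    first
    | exact le_rfl
    | exact le_stepLeft
    | exact le_stepRight
    | exact Sequent.le_def.2 ⟨Set.subset_union_left, subset_rfl, subset_rfl⟩

variable {T : Set Label}

theorem labels_stepLeft_subset (hs : s.labels ⊆ T) (heps : eps ∈ T) (hx : alpha Fr * i ∈ T)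
    (hy : alpha Fr * i + 1 ∈ T) (h : (m, C) ∈ s.left) :
    (stepLeft Fr i m C R s).labels ⊆ T := by
  rw [Sequent.labels_subset_iff] at hs ⊢
  have hm : m ∈ T := hs.2.1 _ h
  obtain ⟨hrel, hleft, hright⟩ := hs
  have htern {x y z} (ht : .tern x y z ∈ s.rel) : x ∈ T ∧ y ∈ T ∧ z ∈ T :=
    RelAtom.args_tern_subset_iff.1 (hrel _ ht)
  unfold stepLeft
  repeat' split
  all_goals
    first
    | exact ⟨hrel, hleft, hright⟩
    | simp only [Set.union_insert, Set.union_singleton, Set.forall_mem_insert,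
        RelAtom.args_eq_subset_iff, RelAtom.args_tern_subset_iff]
      grind

theorem labels_stepRight_subset (hs : s.labels ⊆ T) (hx : alpha Fr * i ∈ T)
    (hy : alpha Fr * i + 1 ∈ T) (h : (m, C) ∈ s.right) :
    (stepRight Fr i m C R s).labels ⊆ T := by
  rw [Sequent.labels_subset_iff] at hs ⊢
  have hm : m ∈ T := hs.2.2 _ h
  obtain ⟨hrel, hleft, hright⟩ := hs
  have htern {x y z} (ht : .tern x y z ∈ s.rel) : x ∈ T ∧ y ∈ T ∧ z ∈ T :=
    RelAtom.args_tern_subset_iff.1 (hrel _ ht)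
  unfold stepRight
  repeat' split
  all_goals
    first
    | exact ⟨hrel, hleft, hright⟩
    | simp only [Set.union_singleton, Set.forall_mem_insert, RelAtom.args_tern_subset_iff]
      grind

theorem labels_step_subset (hs : s.labels ⊆ Set.Iio (alpha Fr * i)) :
    (step i S s).labels ⊆ Set.Iio (alpha Fr * (i + 1)) := by
  have hα := two_le_alpha Fr
  rw [mul_add_one]
  have hs' : s.labels ⊆ Set.Iio (alpha Fr * i + alpha Fr) :=
    hs.trans (Set.Iio_subset_Iio (Nat.le_add_right _ _))
  have hx : alpha Fr * i ∈ Set.Iio (alpha Fr * i + alpha Fr) := Set.mem_Iio.2 (by lia)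
  have hy : alpha Fr * i + 1 ∈ Set.Iio (alpha Fr * i + alpha Fr) := Set.mem_Iio.2 (by lia)
  have heps : eps ∈ Set.Iio (alpha Fr * i + alpha Fr) := Set.mem_Iio.2 (by unfold eps; lia)
  unfold step
  split
  · split <;> split_ifs with h
    exacts [labels_stepLeft_subset hs' heps hx hy h, hs', labels_stepRight_subset hs' hx hy h, hs']
  · split
    · split_ifs with hw
      · exact Sequent.labels_union_rel_subset.2
          ⟨hs', by rintro _ rfl; exact RelAtom.args_eq_subset_iff.2 hw⟩
      · exact Sequent.labels_union_rel_subset.2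
          ⟨hs', by rintro _ rfl; exact RelAtom.args_neq_subset_iff.2 hw⟩
      · exact hs'
    · exact hs'
  · next j θ _ =>
    split_ifs with h
    · refine Sequent.labels_union_rel_subset.2 ⟨hs', fun r hr => ?_⟩
      refine (FrameAxiom.args_subset_of_mem_conclsInst hr).trans (Set.insert_subset heps
        (Set.union_subset ?_ ?_)) <;> rintro _ ⟨v, rfl⟩
      · exact (h.2.2.2 v).trans_le (Nat.le_add_right _ _)
      · exact Nat.add_lt_add_left (v.2.trans_le (n_le_alpha Fr j)) _
    · exact hs'

namespace Derivable

theorem and_of_ite {s t : Sequent P} {_ : Decidable (¬ Derivable Fr s)}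
    (d : Derivable Fr (if ¬ Derivable Fr s then s else t)) : Derivable Fr s ∧ Derivable Fr t := by
  split_ifs at d with h
  · exact ⟨h, d⟩
  · exact absurd d h

theorem of_stepLeft (h : (m, C) ∈ s.left) (hx : s.Fresh (alpha Fr * i))
    (hy : s.Fresh (alpha Fr * i + 1)) (d : Derivable Fr (stepLeft Fr i m C R s)) :
    Derivable Fr s := by
  unfold stepLeft at d
  simp only [Set.union_insert, Set.union_singleton] at d
  split at d
  · exact .andL_of_mem h d
  · exact .impL_of_mem h d.and_of_ite.1 d.and_of_ite.2
  · exact .empL_of_mem h d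
  · exact .starL_of_mem h (by simp) hx hy d
  · split at d
    · split at d
      case isTrue ht => exact .wandL_of_mem ht.1 h ht.2.symm d.and_of_ite.1 d.and_of_ite.2
      case isFalse => exact d
    · exact d
  · exact d

theorem of_stepRight (h : (m, C) ∈ s.right) (hx : s.Fresh (alpha Fr * i))
    (hy : s.Fresh (alpha Fr * i + 1)) (d : Derivable Fr (stepRight Fr i m C R s)) :
    Derivable Fr s := by
  unfold stepRight at d
  simp only [Set.union_singleton] at d
  split at d
  · exact .andR_of_mem h d.and_of_ite.1 d.and_of_ite.2
  · exact .impR_of_mem h d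
  · split at d
    · split at d
      case isTrue ht => exact .starR_of_mem ht.1 h ht.2 d.and_of_ite.1 d.and_of_ite.2
      case isFalse => exact d
    · exact d
  · exact .wandR_of_mem h (by simp) hx hy d
  · exact d

theorem of_step (hfresh : ∀ v, s.Fresh (alpha Fr * i + v)) (d : Derivable Fr (step i S s)) :
    Derivable Fr s := by
  unfold step at d
  split at d
  · split at d <;> split_ifs at d with h
    exacts [d.of_stepLeft h (hfresh 0) (hfresh 1), d, d.of_stepRight h (hfresh 0) (hfresh 1), d]
  · simp only [Set.union_singleton] at d
    split at d
    · split at d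
      · exact .em _ _ d.and_of_ite.1 d.and_of_ite.2
      case isFalse => exact d
    · exact d
  · split_ifs at d with h
    · obtain ⟨-, hsub, he, hθ⟩ := h
      refine .structural_of_subset hsub he (fun v v' hv => ?_) ?_ (fun v => hfresh v) d
      · exact Fin.ext (Nat.add_left_cancel hv)
      · rintro v ⟨u, hu⟩
        exact (hθ u).not_ge (hu ▸ Nat.le_add_right _ _)
    · exact d

end Derivable

end Step

section Limit

open Filter

variable {P : Type*} {q : ℕ} {Fr : Fin q → FrameAxiom} {φ : ℕ → Schedule P Fr} {F : Formula P}

theorem stage_mono : Monotone (stage φ F) :=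
  monotone_nat_of_le_succ fun _ => le_step

theorem stage_le_limitSequent (n : ℕ) : stage φ F n ≤ limitSequent φ F :=
  Sequent.le_def.2 ⟨Set.subset_iUnion (fun n => (stage φ F n).rel) n,
    Set.subset_iUnion (fun n => (stage φ F n).left) n,
    Set.subset_iUnion (fun n => (stage φ F n).right) n⟩

theorem labels_stage_subset (n : ℕ) :
    (stage φ F n).labels ⊆ Set.Iio (alpha Fr * (n + 1)) := by
  induction n with
  | zero =>
    have h : 1 < alpha Fr := two_le_alpha Fr
    simpa [Sequent.labels_subset_iff, stage] using h
  | succ n ih => exact labels_step_subset ih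

theorem finite_labels_stage (n : ℕ) : (stage φ F n).labels.Finite :=
  (Set.finite_Iio _).subset (labels_stage_subset n)

theorem Unprovable.not_derivable_stage (hF : Unprovable Fr F) (n : ℕ) :
    ¬ Derivable Fr (stage φ F n) := by
  induction n with
  | zero => exact hF 1 one_ne_zero
  | succ n ih =>
    exact fun d => ih (d.of_step fun v => Sequent.fresh_of_labels_subset_Iio
      (labels_stage_subset n) (pos_of_gt (lt_alpha_mul_succ Fr n)) (Nat.le_add_right _ v))

theorem eventually_mem_of_mem_iUnion {ι α : Type*} [Preorder ι] [IsDirectedOrder ι] [Nonempty ι]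
    {s : ι → Set α} (hs : Monotone s) {a : α} (ha : a ∈ ⋃ i, s i) : ∀ᶠ i in atTop, a ∈ s i := by
  obtain ⟨i, hi⟩ := Set.mem_iUnion.1 ha
  exact eventually_atTop.2 ⟨i, fun j hij => hs hij hi⟩

theorem eventually_mem_left {c : LFormula P} :
    c ∈ (limitSequent φ F).left → ∀ᶠ n in atTop, c ∈ (stage φ F n).left :=
  eventually_mem_of_mem_iUnion fun _ _ h => (stage_mono h).2.1

theorem eventually_mem_right {c : LFormula P} :
    c ∈ (limitSequent φ F).right → ∀ᶠ n in atTop, c ∈ (stage φ F n).right :=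
  eventually_mem_of_mem_iUnion fun _ _ h => (stage_mono h).2.2

theorem eventually_mem_rel {r : RelAtom Label} :
    r ∈ (limitSequent φ F).rel → ∀ᶠ n in atTop, r ∈ (stage φ F n).rel :=
  eventually_mem_of_mem_iUnion fun _ _ h => (stage_mono h).1

theorem eventually_subset_rel {G : Set (RelAtom Label)} (hG : G.Finite)
    (h : G ⊆ (limitSequent φ F).rel) : ∀ᶠ n in atTop, G ⊆ (stage φ F n).rel :=
  (eventually_all_finite hG).2 fun _ hr => eventually_mem_rel (h hr)

theorem eventually_eqJudg {x y : Label} (h : EqMod (limitSequent φ F).rel x y) :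
    ∀ᶠ n in atTop, EqJudg (stage φ F n).rel x y := by
  obtain ⟨G, hG, hfin, e⟩ := h
  filter_upwards [eventually_subset_rel hfin hG] with n hn using e.mono hn

namespace Unprovable

variable {A : Formula P} {a b : Label}

theorem not_eqMod_of_mem_left_of_mem_right (hF : Unprovable Fr F)
    (ha : (a, A) ∈ (limitSequent φ F).left) (hb : (b, A) ∈ (limitSequent φ F).right) :
    ¬ EqMod (limitSequent φ F).rel a b := fun e =>
  have ⟨n, ha, hb, e⟩ :=
    ((eventually_mem_left ha).and ((eventually_mem_right hb).and (eventually_eqJudg e))).exists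
  hF.not_derivable_stage n (.identity (finite_labels_stage n) ha hb e)

theorem bot_notMem_left (hF : Unprovable Fr F) : (a, .bot) ∉ (limitSequent φ F).left := fun ha =>
  have ⟨n, ha⟩ := (eventually_mem_left ha).exists
  hF.not_derivable_stage n (.botL_of_mem ha)

theorem top_notMem_right (hF : Unprovable Fr F) : (a, .top) ∉ (limitSequent φ F).right := fun ha =>
  have ⟨n, ha⟩ := (eventually_mem_right ha).exists
  hF.not_derivable_stage n (.topR_of_mem ha)

theorem not_eqMod_eps_of_emp_mem_right (hF : Unprovable Fr F)
    (ha : (a, .emp) ∈ (limitSequent φ F).right) : ¬ EqMod (limitSequent φ F).rel a eps := fun e =>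
  have ⟨n, ha, e⟩ := ((eventually_mem_right ha).and (eventually_eqJudg e)).exists
  hF.not_derivable_stage n (.empR_of_mem ha e)

theorem not_eqMod_of_neq_mem_rel (hF : Unprovable Fr F)
    (h : .neq a b ∈ (limitSequent φ F).rel) : ¬ EqMod (limitSequent φ F).rel a b := fun e =>
  have ⟨n, h, e⟩ := ((eventually_mem_rel h).and (eventually_eqJudg e)).exists
  hF.not_derivable_stage n (.nEq_of_mem h e)

end Unprovable

theorem theTern_singleton (x y z : Label) : theTern {.tern x y z} = some (x, y, z) :=
  (theTern_eq_some ..).2 rfl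

namespace Fair

variable {A B C : Formula P} {a b m x y z z' : Label}
  {p : ℕ → Prop}

theorem exists_step_le (hφ : Fair φ) (F : Formula P) (S : Schedule P Fr) (hp : ∀ᶠ n in atTop, p n) :
    ∃ n, p n ∧ step (n + 1) S (stage φ F n) ≤ limitSequent φ F := by
  obtain ⟨N, hN⟩ := eventually_atTop.1 hp
  obtain ⟨_ | n, rfl, hn⟩ := (hφ S).exists_gt N
  · exact absurd hn N.not_lt_zero
  · exact ⟨n, hN n (Nat.le_of_lt_succ hn), stage_le_limitSequent (n + 1)⟩

theorem exists_stepLeft_le (hφ : Fair φ) (h : (m, C) ∈ (limitSequent φ F).left) :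
    ∃ n, stepLeft Fr (n + 1) m C ∅ (stage φ F n) ≤ limitSequent φ F := by
  obtain ⟨n, hm, hle⟩ := hφ.exists_step_le F ⟨.left, m, .fml C, ∅, Nat.zero_le _⟩
    (eventually_mem_left h)
  exact ⟨n, (if_pos hm).ge.trans hle⟩

theorem exists_stepRight_le (hφ : Fair φ) (h : (m, C) ∈ (limitSequent φ F).right) :
    ∃ n, stepRight Fr (n + 1) m C ∅ (stage φ F n) ≤ limitSequent φ F := by
  obtain ⟨n, hm, hle⟩ := hφ.exists_step_le F ⟨.right, m, .fml C, ∅, Nat.zero_le _⟩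
    (eventually_mem_right h)
  exact ⟨n, (if_pos hm).ge.trans hle⟩

theorem eqMod_eps_of_emp_mem_left (hφ : Fair φ) (h : (a, .emp) ∈ (limitSequent φ F).left) :
    EqMod (limitSequent φ F).rel a eps := by
  obtain ⟨n, hrel, -⟩ := hφ.exists_stepLeft_le h
  exact (EqJudg.hyp (hrel (.inr rfl))).eqMod

theorem mem_left_of_and_mem_left (hφ : Fair φ) (h : (a, A.and B) ∈ (limitSequent φ F).left) :
    (a, A) ∈ (limitSequent φ F).left ∧ (a, B) ∈ (limitSequent φ F).left := by
  obtain ⟨n, -, hleft, -⟩ := hφ.exists_stepLeft_le h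
  exact ⟨hleft (.inr (.inl rfl)), hleft (.inr (.inr rfl))⟩

theorem mem_right_of_and_mem_right (hφ : Fair φ) (h : (a, A.and B) ∈ (limitSequent φ F).right) :
    (a, A) ∈ (limitSequent φ F).right ∨ (a, B) ∈ (limitSequent φ F).right := by
  obtain ⟨n, hle⟩ := hφ.exists_stepRight_le h
  simp only [stepRight] at hle
  split at hle <;> obtain ⟨-, -, hright⟩ := hle
  exacts [.inl (hright (.inr rfl)), .inr (hright (.inr rfl))]

theorem mem_right_or_mem_left_of_imp_mem_left (hφ : Fair φ)
    (h : (a, A.imp B) ∈ (limitSequent φ F).left) :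
    (a, A) ∈ (limitSequent φ F).right ∨ (a, B) ∈ (limitSequent φ F).left := by
  obtain ⟨n, hle⟩ := hφ.exists_stepLeft_le h
  simp only [stepLeft] at hle
  split at hle <;> obtain ⟨-, hleft, hright⟩ := hle
  exacts [.inl (hright (.inr rfl)), .inr (hleft (.inr rfl))]

theorem mem_left_and_mem_right_of_imp_mem_right (hφ : Fair φ)
    (h : (a, A.imp B) ∈ (limitSequent φ F).right) :
    (a, A) ∈ (limitSequent φ F).left ∧ (a, B) ∈ (limitSequent φ F).right := by
  obtain ⟨n, -, hleft, hright⟩ := hφ.exists_stepRight_le h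
  exact ⟨hleft (.inr rfl), hright (.inr rfl)⟩

theorem exists_tern_of_star_mem_left (hφ : Fair φ)
    (h : (z, A.star B) ∈ (limitSequent φ F).left) :
    ∃ x y, .tern x y z ∈ (limitSequent φ F).rel ∧ (x, A) ∈ (limitSequent φ F).left ∧
      (y, B) ∈ (limitSequent φ F).left := by
  obtain ⟨n, hrel, hleft, -⟩ := hφ.exists_stepLeft_le h
  exact ⟨_, _, hrel (.inr rfl), hleft (.inr (.inl rfl)), hleft (.inr (.inr rfl))⟩

theorem mem_right_of_star_mem_right (hφ : Fair φ)
    (h : (z, A.star B) ∈ (limitSequent φ F).right)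
    (ht : .tern x y z' ∈ (limitSequent φ F).rel) (e : EqMod (limitSequent φ F).rel z z') :
    (x, A) ∈ (limitSequent φ F).right ∨ (y, B) ∈ (limitSequent φ F).right := by
  obtain ⟨n, ⟨hz, hn⟩, hle⟩ := hφ.exists_step_le F
    ⟨.right, z, .fml (A.star B), {.tern x y z'}, le_max_left _ _⟩
    ((eventually_mem_right h).and ((eventually_mem_rel ht).and (eventually_eqJudg e)))
  simp only [step, if_pos hz, stepRight, theTern_singleton, if_pos hn] at hle
  split at hle <;> obtain ⟨-, -, hright⟩ := hle
  exacts [.inl (hright (.inr rfl)), .inr (hright (.inr rfl))]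

theorem mem_right_or_mem_left_of_wand_mem_left (hφ : Fair φ)
    (h : (z, A.wand B) ∈ (limitSequent φ F).left)
    (ht : .tern x z' y ∈ (limitSequent φ F).rel) (e : EqMod (limitSequent φ F).rel z z') :
    (x, A) ∈ (limitSequent φ F).right ∨ (y, B) ∈ (limitSequent φ F).left := by
  obtain ⟨n, ⟨hz, ht, e⟩, hle⟩ := hφ.exists_step_le F
    ⟨.left, z, .fml (A.wand B), {.tern x z' y}, le_max_left _ _⟩
    ((eventually_mem_left h).and ((eventually_mem_rel ht).and (eventually_eqJudg e)))
  simp only [step, if_pos hz, stepLeft, theTern_singleton, if_pos (And.intro ht e.symm)] at hle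
  split at hle <;> obtain ⟨-, hleft, hright⟩ := hle
  exacts [.inl (hright (.inr rfl)), .inr (hleft (.inr rfl))]

theorem exists_tern_of_wand_mem_right (hφ : Fair φ)
    (h : (z, A.wand B) ∈ (limitSequent φ F).right) :
    ∃ x y, .tern x z y ∈ (limitSequent φ F).rel ∧ (x, A) ∈ (limitSequent φ F).left ∧
      (y, B) ∈ (limitSequent φ F).right := by
  obtain ⟨n, hrel, hleft, hright⟩ := hφ.exists_stepRight_le h
  exact ⟨_, _, hrel (.inr rfl), hleft (.inr rfl), hright (.inr rfl)⟩

theorem neq_mem_rel_or_eqMod (hφ : Fair φ) :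
    .neq a b ∈ (limitSequent φ F).rel ∨ EqMod (limitSequent φ F).rel a b := by
  obtain ⟨n, hn, hle⟩ := hφ.exists_step_le F
    ⟨.left, eps, .em, {.tern a b eps}, le_max_left _ _⟩ (eventually_ge_atTop (max a b))
  have hlt : max a b < alpha Fr * (n + 1) + alpha Fr :=
    (hn.trans_lt (lt_alpha_mul_succ Fr n)).trans_le (Nat.le_add_right _ _)
  simp only [step, theTern_singleton, if_pos (max_lt_iff.1 hlt)] at hle
  split at hle <;> obtain ⟨hrel, -⟩ := hle
  exacts [.inr (EqJudg.hyp (hrel (.inr rfl))).eqMod, .inl (hrel (.inr rfl))]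

theorem exists_conclsInst_subset_rel (hφ : Fair φ) {j : Fin q} {θ : Fin (Fr j).m → Label}
    (h : (Fr j).hypsInst θ ⊆ (limitSequent φ F).rel)
    (e : ∀ e ∈ (Fr j).eqs, EqMod (limitSequent φ F).rel (e.1.inst θ) (e.2.inst θ)) :
    ∃ σ : Fin (Fr j).n → Label, (Fr j).conclsInst θ σ ⊆ (limitSequent φ F).rel := by
  obtain ⟨R, hR, hcard⟩ := (Fr j).exists_finset_coe_eq_hypsInst θ
  have heqs : ∀ᶠ n in atTop, (Fr j).EqsHold (stage φ F n).rel θ :=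
    (eventually_all_finite (List.finite_toSet (Fr j).eqs)).2 fun e' he' =>
      eventually_eqJudg (e e' he')
  have hθ : ∀ᶠ n in atTop, ∀ u, θ u < alpha Fr * (n + 1) := eventually_all.2 fun u =>
    (eventually_ge_atTop (θ u)).mono fun n hn => hn.trans_lt (lt_alpha_mul_succ Fr n)
  obtain ⟨n, hn, hle⟩ := hφ.exists_step_le F
    ⟨.left, eps, .gs j θ, R, hcard.trans ((hyps_length_le_kMax Fr j).trans (le_max_right _ _))⟩
    ((eventually_subset_rel (hR ▸ R.finite_toSet) h).and (heqs.and hθ))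
  simp only [step, if_pos (And.intro hR.symm hn)] at hle
  exact ⟨_, Set.subset_union_right.trans hle.1⟩

end Fair

end Limit

end SepLogic

theorem mainTheorem4 {P : Type*} {q : ℕ} (Fr : Fin q → SepLogic.FrameAxiom)
    (φ : ℕ → SepLogic.Schedule P Fr) (hφ : SepLogic.Fair φ)
    (F : SepLogic.Formula P) (hF : SepLogic.Unprovable Fr F) :
    SepLogic.IsHintikka Fr (SepLogic.limitSequent φ F) :=
  { c1 _ _ _ h := hF.not_eqMod_of_mem_left_of_mem_right h.1 h.2.1 h.2.2
    c2 _ := ⟨hF.bot_notMem_left, hF.top_notMem_right⟩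
    c3 _ := hφ.eqMod_eps_of_emp_mem_left
    c4 _ := hF.not_eqMod_eps_of_emp_mem_right
    c5 _ _ _ := hφ.mem_left_of_and_mem_left
    c6 _ _ _ := hφ.mem_right_of_and_mem_right
    c7 _ _ _ := hφ.mem_right_or_mem_left_of_imp_mem_left
    c8 _ _ _ := hφ.mem_left_and_mem_right_of_imp_mem_right
    c9 _ _ z h :=
      have ⟨x, y, hxyz, hx, hy⟩ := hφ.exists_tern_of_star_mem_left h
      ⟨x, y, z, hxyz, (SepLogic.EqJudg.refl z).eqMod, hx, hy⟩
    c10 _ _ _ h _ _ _ := hφ.mem_right_of_star_mem_right h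
    c11 _ _ _ h _ _ _ := hφ.mem_right_or_mem_left_of_wand_mem_left h
    c12 _ _ z h :=
      have ⟨x, y, hxzy, hx, hy⟩ := hφ.exists_tern_of_wand_mem_right h
      ⟨x, y, z, hxzy, (SepLogic.EqJudg.refl z).eqMod, hx, hy⟩
    c13 _ _ h := hF.not_eqMod_of_neq_mem_rel h.1 h.2
    c14 _ _ := hφ.neq_mem_rel_or_eqMod
    c15 _ _ := hφ.exists_conclsInst_subset_rel }
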